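/- A planar doodle diagram is a connected $4$-valent graph $D$ (loops and multiple edges allowed, with at least one vertex) cellularly embedded in the sphere $S^2$, considered up to homeomorphism, i.e. given by its edges and the cyclic order of the half-edges at each vertex, subject to $V-E+F=2$. Its vertices are called crossings and the components of $S^2\setminus D$ are called regions; the number of edges of a region is the number of edges in its boundary curve. The diagram is minimal if no region has exactly one edge or exactly two edges (no monogons, no bigons). It is prime if its graph is $3$-connected, i.e. it has more than $3$ vertices and is not disconnected by the removal of fewer than $3$ vertices. **Lemma 6.7.** Let $D$ be a minimal prime planar doodle diagram with $n$ crossings. Then every region of $D$ has fewer than $(n+1)/2$ edges. -/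

import Mathlib

/-- A finite cellular 4-valent graph on a closed oriented surface, recorded by its rotation system.
`D` is the set of darts (half-edges, i.e. edges with a chosen direction, based at their tail):
`edge` sends a dart to the other half of its edge, and `rot` sends a dart to the next one,
anticlockwise, based at the same crossing. Every cycle of `rot` has length exactly four. Loops and
multiple edges are allowed. -/
structure FourValentMap (D : Type*) where
  edge : Equiv.Perm D
  rot : Equiv.Perm D
  edge_edge : ∀ d, edge (edge d) = d
  edge_ne : ∀ d, edge d ≠ d
  rot_four : ∀ d, (rot ^ 4) d = d
  rot_two_ne : ∀ d, (rot ^ 2) d ≠ d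

namespace FourValentMap

variable {D : Type*} (X : FourValentMap D)

/-- The permutation tracing the boundary curves of the regions: run along a dart to the crossing at
its head, and leave that crossing by the neighbouring dart. -/
def face : Equiv.Perm D := X.rot * X.edge

/-- The crossings (vertices) are the cycles of `rot`. -/
abbrev Crossing : Type _ := Quotient (Equiv.Perm.SameCycle.setoid X.rot)

/-- The edges are the cycles of `edge`, i.e. the pairs of opposite darts. -/
abbrev Edge : Type _ := Quotient (Equiv.Perm.SameCycle.setoid X.edge)

/-- The regions (2-cells) are the cycles of `face`. -/
abbrev Region : Type _ := Quotient (Equiv.Perm.SameCycle.setoid X.face)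

/-- The crossing at which a dart is based. -/
def crossingOf (d : D) : X.Crossing := Quotient.mk _ d

/-- The region whose boundary curve runs along a given dart. -/
def regionOf (d : D) : X.Region := Quotient.mk _ d

/-- The number of edges in the boundary curve of a region (an edge having the region on both of its
sides is run along twice, and counted twice). A region `r` is an `i`-gon if `X.size r = i`. -/
noncomputable def size (r : X.Region) : ℕ := Nat.card {d : D // X.regionOf d = r}

/-- The 1-skeleton, as a simple graph on the crossings: two distinct crossings are adjacent if they
are joined by an edge. (Loops and multiplicities play no role in vertex connectivity.) -/
def skeleton : SimpleGraph X.Crossing where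
  Adj u v := u ≠ v ∧ ∃ d : D, X.crossingOf d = u ∧ X.crossingOf (X.edge d) = v
  symm := ⟨by
    rintro u v ⟨huv, d, hu, hv⟩
    exact ⟨huv.symm, X.edge d, hv, by rw [X.edge_edge, hu]⟩⟩
  loopless := ⟨fun _ h => h.1 rfl⟩

end FourValentMap

/-- A graph is `k`-connected if it has more than `k` vertices and is not disconnected whenever fewer
than `k` vertices are removed. -/
def SimpleGraph.IsKConnected {V : Type*} (G : SimpleGraph V) (k : ℕ) : Prop :=
  (k : ℕ∞) < ENat.card V ∧ ∀ S : Finset V, S.card < k → (G.induce {v | v ∉ S}).Connected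

/-- A (connected, non-trivial, planar) doodle diagram: a connected 4-valent graph, with at least one
crossing, cellularly embedded in the sphere. Connectedness says that any two darts are related by
the group generated by `edge` and `rot`; the underlying closed surface is the sphere exactly when
its Euler characteristic is `2`. -/
structure DoodleDiagram (D : Type*) extends FourValentMap D where
  connected : ∀ d d' : D, ∃ g ∈ Subgroup.closure {edge, rot}, g d = d'
  spherical : (Nat.card toFourValentMap.Crossing : ℤ) - Nat.card toFourValentMap.Edge
    + Nat.card toFourValentMap.Region = 2

namespace DoodleDiagram

variable {D : Type*} (X : DoodleDiagram D)

/-- The number of crossings. -/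
noncomputable def crossingNumber : ℕ := Nat.card X.Crossing

/-- A diagram (connected by definition here) is minimal if it has no monogon and no bigon. -/
def IsMinimal : Prop := ∀ r : X.Region, X.size r ≠ 1 ∧ X.size r ≠ 2

/-- A diagram is prime if it is 3-connected. -/
def IsPrime : Prop := X.skeleton.IsKConnected 3

end DoodleDiagram

/-! Checkerboard-colour the regions. At each crossing met by a region `r`, the region opposite `r`
has the same colour. If these opposite regions are distinct from `r` and from each other, then, each
having at least 3 edges, they and `r` occupy at least `4 * size r` darts of one colour. Only `2n` of
the `4n` darts have that colour, so `2 * size r ≤ n`. Distinctness (`regionOf_rot_rot_ne`,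
`regionOf_rot_rot_injective`) is a Jordan curve argument. A coincidence gives a closed curve meeting
the diagram in one or two crossings. By 3-connectivity all other crossings lie on one side, so the
other side holds only a loop or a pair of parallel edges, that is, a monogon or a bigon.
`exists_potential` replaces the Jordan curve theorem: mod 2 cohomology vanishes in degree one, by a
dimension count from Euler's formula. It gives the two sides of a curve as a `ZMod 2`-valued
function on edges, and it also yields the colouring. -/

theorem Equiv.Perm.apply_eq_of_mem_closure {α β : Type*} {S : Set (Equiv.Perm α)} {s : α → β}
    (hs : ∀ f ∈ S, ∀ d, s (f d) = s d) {g : Equiv.Perm α} (hg : g ∈ Subgroup.closure S) (d : α) :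
    s (g d) = s d := by
  induction hg using Subgroup.closure_induction generalizing d with
  | mem f hf => exact hs f hf d
  | one => rfl
  | mul f g _ _ hf hg => rw [Equiv.Perm.mul_apply, hf, hg]
  | inv f _ hf => rw [← hf (f⁻¹ d)]; exact congrArg s (f.apply_symm_apply d)

theorem Equiv.Perm.SameCycle.apply_eq {α β : Type*} {f : Equiv.Perm α} {s : α → β}
    (hs : ∀ d, s (f d) = s d) {x y : α} (h : f.SameCycle x y) : s x = s y := by
  obtain ⟨i, rfl⟩ := h
  refine (Equiv.Perm.apply_eq_of_mem_closure (S := {f}) (by simpa using hs) ?_ x).symm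
  exact Subgroup.zpow_mem _ (Subgroup.subset_closure (Set.mem_singleton f)) i

/-- The cycles of a permutation of period `m` are enumerated by its first `m` powers. -/
theorem Equiv.Perm.SameCycle.exists_pow_lt {α : Type*} {f : Equiv.Perm α} {m : ℕ} (hm : 0 < m)
    (hf : ∀ d, (f ^ m) d = d) {x y : α} (h : f.SameCycle x y) : ∃ i < m, (f ^ i) x = y := by
  have h1 : f ^ m = 1 := Equiv.ext hf
  obtain ⟨i, rfl⟩ := h
  have hm' : (m : ℤ) ≠ 0 := by omega
  refine ⟨(i % m).toNat, by have := Int.emod_lt_of_pos i (b := m) (by omega); omega, ?_⟩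
  rw [← zpow_natCast, Int.toNat_of_nonneg (Int.emod_nonneg _ hm')]
  conv_rhs => rw [← Int.emod_add_mul_ediv i m, zpow_add, zpow_mul, zpow_natCast, h1, one_zpow,
    mul_one]

/-- A permutation of period `m` all of whose cycles have exactly `m` elements has `|α| / m`
cycles. -/
theorem Equiv.Perm.card_eq_mul_card_cycles {α : Type*} [Finite α] {f : Equiv.Perm α} {m : ℕ}
    (hm : 0 < m) (hf : ∀ d, (f ^ m) d = d) (hinj : ∀ d, ∀ i < m, 0 < i → (f ^ i) d ≠ d) :
    Nat.card α = m * Nat.card (Quotient (Equiv.Perm.SameCycle.setoid f)) := by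
  classical
  cases nonempty_fintype α
  rw [Nat.card_eq_fintype_card, Nat.card_eq_fintype_card, mul_comm, ← Finset.card_univ,
    ← Finset.card_univ]
  refine Finset.card_eq_sum_card_fiberwise
    (f := fun d => (Quotient.mk (Equiv.Perm.SameCycle.setoid f) d)) (t := Finset.univ)
    (by simp) |>.trans ?_
  rw [Finset.sum_const_nat]
  intro q _
  induction q using Quotient.inductionOn with
  | h x =>
    have : (Finset.univ.filter fun d => (Quotient.mk (Equiv.Perm.SameCycle.setoid f) d)
        = Quotient.mk _ x) = (Finset.range m).image (fun i => (f ^ i) x) := by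
      ext y
      simp only [Finset.mem_filter, Finset.mem_univ, true_and, Finset.mem_image, Finset.mem_range]
      rw [Quotient.eq]
      constructor
      · intro h
        exact Equiv.Perm.SameCycle.exists_pow_lt hm hf (Equiv.Perm.SameCycle.symm h)
      · rintro ⟨i, -, rfl⟩
        exact Equiv.Perm.SameCycle.symm ⟨i, by simp⟩
    rw [this, Finset.card_image_of_injOn, Finset.card_range]
    have key : ∀ i j, j < m → i < j → (f ^ i) x ≠ (f ^ j) x := by
      intro i j hj hij h
      refine hinj ((f ^ i) x) (j - i) (by omega) (by omega) ?_
      rw [← Equiv.Perm.mul_apply, ← pow_add, Nat.sub_add_cancel hij.le, h]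
    intro i hi j hj hij
    simp only [Finset.coe_range, Set.mem_Iio] at hi hj
    rcases lt_trichotomy i j with h | h | h
    · exact absurd hij (key i j hj h)
    · exact h
    · exact absurd hij.symm (key j i hi h)

/-! ### Local structure at a crossing, and dart counts. -/

namespace FourValentMap

variable {D : Type*} (X : FourValentMap D)

theorem rot_rot_ne (d : D) : X.rot (X.rot d) ≠ d := X.rot_two_ne d

theorem rot_rot_rot_rot (d : D) : X.rot (X.rot (X.rot (X.rot d))) = d := X.rot_four d

theorem rot_ne (d : D) : X.rot d ≠ d := fun h => X.rot_rot_ne d (by rw [h, h])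

theorem rot_rot_rot_ne (d : D) : X.rot (X.rot (X.rot d)) ≠ d := fun h =>
  X.rot_ne d (by rw [← h, X.rot_rot_rot_rot, h])

theorem crossingOf_rot (d : D) : X.crossingOf (X.rot d) = X.crossingOf d :=
  Quotient.sound (Equiv.Perm.SameCycle.symm ⟨1, rfl⟩)

theorem regionOf_face (d : D) : X.regionOf (X.rot (X.edge d)) = X.regionOf d :=
  Quotient.sound (Equiv.Perm.SameCycle.symm ⟨1, rfl⟩)

theorem regionOf_rot (d : D) : X.regionOf (X.rot d) = X.regionOf (X.edge d) := by
  rw [← X.regionOf_face (X.edge d), X.edge_edge]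

theorem eq_of_crossingOf_eq {x y : D} (h : X.crossingOf x = X.crossingOf y) :
    y = x ∨ y = X.rot x ∨ y = X.rot (X.rot x) ∨ y = X.rot (X.rot (X.rot x)) := by
  obtain ⟨i, hi, rfl⟩ := Equiv.Perm.SameCycle.exists_pow_lt (by norm_num) X.rot_four
    (Quotient.exact h)
  interval_cases i
  · exact Or.inl rfl
  · exact Or.inr (Or.inl rfl)
  · exact Or.inr (Or.inr (Or.inl rfl))
  · exact Or.inr (Or.inr (Or.inr rfl))

theorem card_dart_eq_two_mul [Finite D] : Nat.card D = 2 * Nat.card X.Edge := by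
  refine Equiv.Perm.card_eq_mul_card_cycles (by norm_num) (fun d => X.edge_edge d) ?_
  intro d i hi hi'
  interval_cases i
  exact X.edge_ne d

theorem card_dart_eq_four_mul [Finite D] : Nat.card D = 4 * Nat.card X.Crossing := by
  refine Equiv.Perm.card_eq_mul_card_cycles (by norm_num) X.rot_four ?_
  intro d i hi hi'
  interval_cases i
  · exact X.rot_ne d
  · exact X.rot_rot_ne d
  · exact X.rot_rot_rot_ne d

/-! ### The mod 2 complex of edges, corners, and crossings with regions (the medial graph). -/

/-- The coboundary from edges to corners; the corner of `d` lies between `d` and `rot d`. -/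
def edgeCoboundary : (X.Edge → ZMod 2) →ₗ[ZMod 2] (D → ZMod 2) where
  toFun s d := s (Quotient.mk _ (X.rot d)) + s (Quotient.mk _ d)
  map_add' s t := by ext d; simp only [Pi.add_apply]; ring
  map_smul' c s := by ext d; simp only [Pi.smul_apply, smul_eq_mul, RingHom.id_apply]; ring

/-- The transpose of the coboundary from corners to crossings and regions. -/
def cornerBoundary :
    ((X.Crossing → ZMod 2) × (X.Region → ZMod 2)) →ₗ[ZMod 2] (D → ZMod 2) where
  toFun p d := p.1 (X.crossingOf d) + p.2 (X.regionOf (X.rot d))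
  map_add' p q := by ext d; simp only [Prod.fst_add, Prod.snd_add, Pi.add_apply]; ring
  map_smul' c p := by
    ext d; simp only [Prod.smul_fst, Prod.smul_snd, Pi.smul_apply, smul_eq_mul,
      RingHom.id_apply]; ring

/-- Around a crossing or a region, each edge value enters through the two corners flanking it and
cancels mod 2. -/
theorem sum_edgeCoboundary_mul_cornerBoundary [Fintype D] {s : D → ZMod 2}
    (hs : ∀ d, s (X.edge d) = s d) (a : X.Crossing → ZMod 2) (b : X.Region → ZMod 2) :
    ∑ d, (s (X.rot d) + s d) * (a (X.crossingOf d) + b (X.regionOf (X.rot d))) = 0 := by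
  have h1 : ∑ d, s (X.rot d) * a (X.crossingOf d) = ∑ d, s d * a (X.crossingOf d) := by
    rw [← Equiv.sum_comp X.rot (fun d => s d * a (X.crossingOf d))]
    simp only [crossingOf_rot]
  have h2 : ∑ d, s (X.rot d) * b (X.regionOf (X.rot d)) = ∑ d, s d * b (X.regionOf d) :=
    Equiv.sum_comp X.rot (fun d => s d * b (X.regionOf d))
  have h3 : ∑ d, s d * b (X.regionOf (X.rot d)) = ∑ d, s d * b (X.regionOf d) := by
    rw [← Equiv.sum_comp X.edge (fun d => s d * b (X.regionOf d))]
    simp only [regionOf_rot, hs]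
  simp only [add_mul, mul_add, Finset.sum_add_distrib, h1, h2, h3]
  simp only [CharTwo.add_self_eq_zero]

/-! ### Consequences of minimality and connectivity. -/

theorem not_face_face_eq [Finite D] (hmin : ∀ r : X.Region, X.size r ≠ 1 ∧ X.size r ≠ 2) (z : D) :
    X.face (X.face z) ≠ z := by
  intro h
  have hset : {d : D | X.regionOf d = X.regionOf z} = {z, X.face z} := by
    ext d
    simp only [Set.mem_ofPred_eq, Set.mem_insert_iff, Set.mem_singleton_iff]
    constructor
    · intro hd
      have hmem : ∀ i : ℤ, (X.face ^ i) z = z ∨ (X.face ^ i) z = X.face z := by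
        intro i
        have h2 : (X.face ^ (2 : ℤ)) z = z := h
        rcases Int.even_or_odd' i with ⟨j, rfl | rfl⟩
        · left
          rw [zpow_mul]
          exact Equiv.Perm.zpow_apply_eq_self_of_apply_eq_self h2 j
        · right
          rw [add_comm, zpow_add, zpow_mul, Equiv.Perm.mul_apply,
            Equiv.Perm.zpow_apply_eq_self_of_apply_eq_self h2 j, zpow_one]
      obtain ⟨i, rfl⟩ := Equiv.Perm.SameCycle.symm (Quotient.exact hd)
      exact hmem i
    · rintro (rfl | rfl)
      · rfl
      · exact X.regionOf_face z
  have hcard : X.size (X.regionOf z) = ({z, X.face z} : Set D).ncard := by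
    rw [← hset]; rfl
  by_cases hz : z = X.face z
  · exact (hmin _).1 (by rw [hcard, ← hz]; simp)
  · exact (hmin _).2 (by rw [hcard, Set.ncard_pair hz])

theorem edge_ne_rot [Finite D] (hmin : ∀ r : X.Region, X.size r ≠ 1 ∧ X.size r ≠ 2) (x : D) :
    X.edge x ≠ X.rot x := by
  intro h
  have : X.face (X.rot x) = X.rot x := by
    change X.rot (X.edge (X.rot x)) = X.rot x
    rw [← h, X.edge_edge]; exact h.symm
  exact X.not_face_face_eq hmin (X.rot x) (by rw [this, this])

theorem three_le_size [Finite D] (hmin : ∀ r : X.Region, X.size r ≠ 1 ∧ X.size r ≠ 2)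
    (r : X.Region) : 3 ≤ X.size r := by
  have h0 : X.size r ≠ 0 := by
    induction r using Quotient.inductionOn with
    | h d =>
      have : Nonempty {x : D // X.regionOf x = Quotient.mk _ d} := ⟨⟨d, rfl⟩⟩
      exact Nat.card_pos.ne'
  have := hmin r
  omega

/-- If `s` jumps only at the crossings of a set whose removal does not disconnect the skeleton,
then it is constant away from those crossings. -/
theorem exists_eq_of_connected {β : Type*} {S : Finset X.Crossing}
    (hS : (X.skeleton.induce {v | v ∉ S}).Connected) {s : D → β}
    (hedge : ∀ d, s (X.edge d) = s d) (hrot : ∀ d, X.crossingOf d ∉ S → s (X.rot d) = s d) :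
    ∃ t, ∀ d, X.crossingOf d ∉ S → s d = t := by
  have hcross : ∀ x y, X.crossingOf x = X.crossingOf y → X.crossingOf x ∉ S → s x = s y := by
    intro x y h hx
    rcases X.eq_of_crossingOf_eq h with rfl | rfl | rfl | rfl
    · rfl
    · rw [hrot _ (by simpa only [crossingOf_rot])]
    · rw [hrot _ (by simpa only [crossingOf_rot]), hrot _ (by simpa only [crossingOf_rot])]
    · rw [hrot _ (by simpa only [crossingOf_rot]), hrot _ (by simpa only [crossingOf_rot]),
        hrot _ (by simpa only [crossingOf_rot])]
  have hwalk : ∀ u w : {v | v ∉ S}, (X.skeleton.induce {v | v ∉ S}).Reachable u w →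
      ∀ d d', X.crossingOf d = u → X.crossingOf d' = w → s d = s d' := by
    rintro u w ⟨p⟩
    induction p with
    | @nil u => intro d d' h h'; exact hcross d d' (h.trans h'.symm) (by rw [h]; exact u.2)
    | @cons u _ _ hadj p ih =>
      intro d d' h h'
      obtain ⟨-, e, he, he'⟩ := hadj
      rw [hcross d e (h.trans he.symm) (by rw [h]; exact u.2), ← hedge]
      exact ih _ _ he' h'
  obtain ⟨⟨u, hu⟩⟩ := hS.nonempty
  induction u using Quotient.inductionOn with
  | h d₀ =>
    exact ⟨s d₀, fun d hd => hwalk ⟨_, hd⟩ ⟨_, hu⟩ (hS.preconnected _ _) d d₀ rfl rfl⟩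

end FourValentMap

/-! ### Vanishing cohomology and the checkerboard colouring. -/

namespace DoodleDiagram

variable {D : Type*} (X : DoodleDiagram D)

theorem apply_eq_of_invariant {β : Type*} {s : D → β} (hedge : ∀ d, s (X.edge d) = s d)
    (hrot : ∀ d, s (X.rot d) = s d) (d d' : D) : s d = s d' := by
  obtain ⟨g, hg, rfl⟩ := X.connected d d'
  refine (Equiv.Perm.apply_eq_of_mem_closure ?_ hg d).symm
  rintro f (rfl | rfl)
  exacts [hedge, hrot]

theorem nonempty_dart (X : DoodleDiagram D) : Nonempty D := by
  by_contra h
  rw [not_nonempty_iff] at h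
  have := X.spherical
  simp at this

/-- Connectedness forces kernel elements to be constant, so evaluation at one edge is injective. -/
theorem finrank_ker_edgeCoboundary_le :
    Module.finrank (ZMod 2) (LinearMap.ker X.edgeCoboundary) ≤ 1 := by
  obtain ⟨d₀⟩ := X.nonempty_dart
  let ev : LinearMap.ker X.edgeCoboundary →ₗ[ZMod 2] ZMod 2 :=
    (LinearMap.proj (Quotient.mk _ d₀ : X.Edge)).comp (Submodule.subtype _)
  have hinj : Function.Injective ev := by
    rw [← LinearMap.ker_eq_bot, LinearMap.ker_eq_bot']
    rintro ⟨s, hs⟩ h0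
    have h0' : s (Quotient.mk _ d₀) = 0 := h0
    rw [Subtype.ext_iff]
    ext q
    induction q using Quotient.inductionOn with
    | h d =>
      refine Eq.trans ?_ h0'
      refine X.apply_eq_of_invariant (s := fun d => s (Quotient.mk _ d)) ?_ ?_ d d₀
      · intro d
        exact congrArg s (Quotient.sound (Equiv.Perm.SameCycle.symm ⟨1, rfl⟩))
      · intro d
        have := congrFun (LinearMap.mem_ker.1 hs) d
        exact CharTwo.add_eq_zero.1 this
  simpa using LinearMap.finrank_le_finrank_of_injective hinj

theorem finrank_ker_cornerBoundary_le :
    Module.finrank (ZMod 2) (LinearMap.ker X.cornerBoundary) ≤ 1 := by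
  obtain ⟨d₀⟩ := X.nonempty_dart
  let ev : LinearMap.ker X.cornerBoundary →ₗ[ZMod 2] ZMod 2 :=
    (LinearMap.proj (X.crossingOf d₀)).comp
      ((LinearMap.fst _ _ _).comp (Submodule.subtype _))
  have hinj : Function.Injective ev := by
    rw [← LinearMap.ker_eq_bot, LinearMap.ker_eq_bot']
    rintro ⟨⟨a, b⟩, hs⟩ h0
    have h0' : a (X.crossingOf d₀) = 0 := h0
    have hab : ∀ d, a (X.crossingOf d) = b (X.regionOf (X.rot d)) := fun d =>
      CharTwo.add_eq_zero.1 (congrFun (LinearMap.mem_ker.1 hs) d)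
    have hab' : ∀ d, a (X.crossingOf d) = b (X.regionOf d) := fun d => by
      obtain ⟨d, rfl⟩ := X.rot.surjective d
      rw [X.crossingOf_rot, hab]
    have ha : ∀ d, a (X.crossingOf d) = 0 := fun d => by
      rw [← h0']
      refine X.apply_eq_of_invariant (s := fun d => a (X.crossingOf d)) ?_ ?_ d d₀
      · intro d
        rw [hab', ← X.regionOf_rot, ← hab]
      · intro d
        rw [X.crossingOf_rot]
    rw [Subtype.ext_iff, Prod.ext_iff]
    refine ⟨funext fun q => ?_, funext fun q => ?_⟩
    · induction q using Quotient.inductionOn with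
      | h d => exact ha d
    · induction q using Quotient.inductionOn with
      | h d => exact (hab' d).symm.trans (ha d)
  simpa using LinearMap.finrank_le_finrank_of_injective hinj

/-- The first cohomology of the sphere vanishes: a `ZMod 2`-valued function on corners, orthogonal
to all crossings and regions, is the coboundary of a function on edges. -/
theorem exists_potential [Fintype D] (ψ : D → ZMod 2)
    (hψ : ∀ (a : X.Crossing → ZMod 2) (b : X.Region → ZMod 2),
      ∑ d, ψ d * (a (X.crossingOf d) + b (X.regionOf (X.rot d))) = 0) :
    ∃ s : D → ZMod 2, (∀ d, s (X.edge d) = s d) ∧ ∀ d, s (X.rot d) = s d + ψ d := by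
  classical
  have : Fintype X.Crossing := Fintype.ofFinite _
  have : Fintype X.Region := Fintype.ofFinite _
  have : Fintype X.Edge := Fintype.ofFinite _
  let P := X.cornerBoundary.dualMap ∘ₗ (dotProductEquiv (ZMod 2) D).toLinearMap
  have hmem : ∀ φ : D → ZMod 2, φ ∈ LinearMap.ker P ↔
      ∀ (a : X.Crossing → ZMod 2) (b : X.Region → ZMod 2),
      ∑ d, φ d * (a (X.crossingOf d) + b (X.regionOf (X.rot d))) = 0 := by
    intro φ
    rw [LinearMap.mem_ker]
    constructor
    · intro h a b
      exact LinearMap.congr_fun h (a, b)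
    · intro h
      refine LinearMap.ext fun p => ?_
      exact h p.1 p.2
  have hedge : ∀ (s : X.Edge → ZMod 2) d,
      s (Quotient.mk _ (X.edge d)) = s (Quotient.mk _ d) := fun s d =>
    congrArg s (Quotient.sound (Equiv.Perm.SameCycle.symm ⟨1, rfl⟩))
  have hle : LinearMap.range X.edgeCoboundary ≤ LinearMap.ker P := by
    rintro _ ⟨s, rfl⟩
    rw [hmem]
    exact X.sum_edgeCoboundary_mul_cornerBoundary (s := fun d => s (Quotient.mk _ d)) (hedge s)
  have hP : Module.finrank (ZMod 2) (LinearMap.range P)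
      = Module.finrank (ZMod 2) (LinearMap.range X.cornerBoundary) := by
    rw [← LinearMap.finrank_range_dualMap_eq_finrank_range (f := X.cornerBoundary),
      ← LinearMap.range_comp_of_range_eq_top X.cornerBoundary.dualMap
      (LinearEquiv.range (dotProductEquiv (ZMod 2) D))]
  have r1 := LinearMap.finrank_range_add_finrank_ker P
  have r2 := LinearMap.finrank_range_add_finrank_ker X.cornerBoundary
  have r3 := LinearMap.finrank_range_add_finrank_ker X.edgeCoboundary
  have k2 := X.finrank_ker_cornerBoundary_le
  have k3 := X.finrank_ker_edgeCoboundary_le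
  have hE := X.card_dart_eq_two_mul
  have hχ := X.spherical
  simp only [Module.finrank_prod, Module.finrank_fintype_fun_eq_card] at r1 r2 r3
  simp only [Nat.card_eq_fintype_card] at hE hχ
  -- The range has dimension at least `E - 1`; the kernel has dimension at most `2E - (V + F - 1)`,
  -- which is `E - 1` by Euler's formula.
  have heq : LinearMap.range X.edgeCoboundary = LinearMap.ker P :=
    Submodule.eq_of_le_of_finrank_le hle (by omega)
  obtain ⟨s, hs⟩ : ψ ∈ LinearMap.range X.edgeCoboundary := by rw [heq, hmem]; exact hψ
  refine ⟨fun d => s (Quotient.mk _ d), hedge s, fun d => ?_⟩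
  rw [← hs]
  change _ = s (Quotient.mk _ d) + (s (Quotient.mk _ (X.rot d)) + s (Quotient.mk _ d))
  rw [add_comm (s (Quotient.mk _ (X.rot d))), CharTwo.add_cancel_left]

/-- The checkerboard colouring of the regions. -/
theorem exists_coloring [Fintype D] : ∃ c : D → ZMod 2, (∀ d, c (X.edge d) = c d + 1) ∧
    (∀ d, c (X.rot d) = c d + 1) ∧ ∀ x y, X.regionOf x = X.regionOf y → c x = c y := by
  classical
  obtain ⟨o, ho⟩ : ∃ o : D → ZMod 2, ∀ d, o (X.edge d) = o d + 1 := by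
    let f : D → D := fun d => Quotient.out (Quotient.mk _ d : X.Edge)
    have hf : ∀ d, f (X.edge d) = f d := fun d =>
      congrArg Quotient.out (Quotient.sound (Equiv.Perm.SameCycle.symm ⟨1, rfl⟩))
    have hf' : ∀ d, f d = d ∨ f d = X.edge d := fun d => by
      obtain ⟨i, hi, h⟩ := Equiv.Perm.SameCycle.exists_pow_lt (m := 2) (by norm_num)
        (fun d => X.edge_edge d) (Equiv.Perm.SameCycle.symm
          (Quotient.mk_out (s := Equiv.Perm.SameCycle.setoid X.edge) d))
      interval_cases i
      · exact Or.inl h.symm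
      · exact Or.inr h.symm
    refine ⟨fun d => if f d = d then 0 else 1, fun d => ?_⟩
    simp only [hf]
    rcases hf' d with h | h
    · rw [h, if_pos rfl, if_neg (X.edge_ne d).symm, zero_add]
    · rw [h, if_pos rfl, if_neg (X.edge_ne d)]; rfl
  -- Here `o` orients the edges. This corner function is chosen so that `s + o` flips along both
  -- `edge` and `rot`.
  obtain ⟨s, hs, hs'⟩ := X.exists_potential (fun d => 1 + o d + o (X.rot d)) (by
    intro a b
    have h1 : ∑ d, o (X.rot d) * a (X.crossingOf d) = ∑ d, o d * a (X.crossingOf d) := by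
      rw [← Equiv.sum_comp X.rot (fun d => o d * a (X.crossingOf d))]
      simp only [X.crossingOf_rot]
    have h2 : ∑ d, o (X.rot d) * b (X.regionOf (X.rot d)) = ∑ d, o d * b (X.regionOf d) :=
      Equiv.sum_comp X.rot (fun d => o d * b (X.regionOf d))
    have h3 : ∑ d, (1 + o d) * b (X.regionOf (X.rot d)) = ∑ d, o d * b (X.regionOf d) := by
      rw [← Equiv.sum_comp X.edge (fun d => o d * b (X.regionOf d))]
      simp only [X.regionOf_rot, ho, add_comm]
    have h4 : ∑ d, a (X.crossingOf d) = 0 := by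
      refine Finset.sum_involution (fun d _ => X.rot (X.rot d)) ?_ ?_ ?_ ?_
      · intro d _
        simp only [X.crossingOf_rot, CharTwo.add_self_eq_zero]
      · intro d _ _
        exact X.rot_rot_ne d
      · simp
      · intro d _
        exact X.rot_rot_rot_rot d
    calc ∑ d, (1 + o d + o (X.rot d)) * (a (X.crossingOf d) + b (X.regionOf (X.rot d)))
        = ∑ d, a (X.crossingOf d) + (∑ d, o d * a (X.crossingOf d)
          + ∑ d, o (X.rot d) * a (X.crossingOf d))
          + (∑ d, (1 + o d) * b (X.regionOf (X.rot d))
          + ∑ d, o (X.rot d) * b (X.regionOf (X.rot d))) := by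
          simp only [← Finset.sum_add_distrib]
          exact Finset.sum_congr rfl fun d _ => by ring
      _ = 0 := by rw [h1, h2, h3, h4]; simp only [CharTwo.add_self_eq_zero])
  have hedge : ∀ d, s (X.edge d) + o (X.edge d) = s d + o d + 1 := fun d => by
    rw [hs, ho]; ring
  have hrot : ∀ d, s (X.rot d) + o (X.rot d) = s d + o d + 1 := fun d => by
    rw [hs']
    linear_combination CharTwo.add_self_eq_zero (o (X.rot d))
  refine ⟨fun d => s d + o d, hedge, hrot, fun x y h => ?_⟩
  refine Equiv.Perm.SameCycle.apply_eq (f := X.face) (s := fun d => s d + o d) ?_ (Quotient.exact h)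
  intro d
  change s (X.rot (X.edge d)) + o (X.rot (X.edge d)) = _
  rw [hrot, hedge, CharTwo.add_cancel_right]

/-! ### Diagonals through crossings, and distinctness of opposite regions. -/

/-- The two corners at a crossing that are met by a diagonal from the region of `d` to the opposite
one. -/
def diagonal [DecidableEq D] (d : D) : D → ZMod 2 :=
  Pi.single (X.rot (X.rot (X.rot d))) 1 + Pi.single (X.rot d) 1

theorem diagonal_self [DecidableEq D] (d : D) : X.diagonal d d = 0 := by
  simp [diagonal, (X.rot_rot_rot_ne d).symm, (X.rot_ne d).symm]

theorem diagonal_rot [DecidableEq D] (d : D) : X.diagonal d (X.rot d) = 1 := by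
  simp [diagonal, (X.rot_rot_ne d).symm]

theorem diagonal_rot_rot [DecidableEq D] (d : D) : X.diagonal d (X.rot (X.rot d)) = 0 := by
  simp [diagonal, (X.rot_ne _).symm, X.rot_ne]

theorem diagonal_of_crossingOf_ne [DecidableEq D] {d e : D}
    (h : X.crossingOf e ≠ X.crossingOf d) : X.diagonal d e = 0 := by
  have h1 : e ≠ X.rot d := by rintro rfl; exact h (X.crossingOf_rot d)
  have h3 : e ≠ X.rot (X.rot (X.rot d)) := by
    rintro rfl; exact h (by simp only [X.crossingOf_rot])
  simp [diagonal, h1, h3]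

theorem sum_diagonal_mul [Fintype D] [DecidableEq D] (d : D) (a : X.Crossing → ZMod 2)
    (b : X.Region → ZMod 2) :
    ∑ e, X.diagonal d e * (a (X.crossingOf e) + b (X.regionOf (X.rot e)))
      = b (X.regionOf d) + b (X.regionOf (X.rot (X.rot d))) := by
  simp only [diagonal, Pi.add_apply, Pi.single_apply, add_mul, ite_mul, one_mul, zero_mul,
    Finset.sum_add_distrib, Finset.sum_ite_eq', Finset.mem_univ, if_true, X.crossingOf_rot,
    X.rot_rot_rot_rot]
  linear_combination CharTwo.add_self_eq_zero (a (X.crossingOf d))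

/-- One of the two sides into which a diagonal cuts a crossing carries the value `t + 1`. -/
theorem exists_side {s : D → ZMod 2} {d : D} (h0 : s (X.rot d) = s d)
    (h1 : s (X.rot (X.rot d)) = s (X.rot d) + 1)
    (h2 : s (X.rot (X.rot (X.rot d))) = s (X.rot (X.rot d))) (t : ZMod 2) :
    ∃ x, (x = d ∨ x = X.rot (X.rot d)) ∧ s x ≠ t ∧ s (X.rot (X.rot x)) = t ∧
      s (X.rot (X.rot (X.rot x))) = t := by
  have key : ∀ u v : ZMod 2, u ≠ v → u + 1 = v := by decide
  by_cases h : s d = t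
  · refine ⟨X.rot (X.rot d), Or.inr rfl, ?_, ?_, ?_⟩
    · rw [h1, h0, h]
      intro h'
      exact one_ne_zero (left_eq_add.1 h'.symm)
    · rw [X.rot_rot_rot_rot, h]
    · rw [X.rot_rot_rot_rot, h0, h]
  · exact ⟨d, Or.inl rfl, h, by rw [h1, h0, key _ _ h], by rw [h2, h1, h0, key _ _ h]⟩

/-- Otherwise the diagonal closes up. The side free of other crossings contains just two adjacent
darts, which must form one loop bounding a monogon. -/
theorem regionOf_rot_rot_ne [Finite D] (hmin : X.IsMinimal) (hprime : X.IsPrime) (d : D) :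
    X.regionOf (X.rot (X.rot d)) ≠ X.regionOf d := by
  classical
  cases nonempty_fintype D
  intro hd
  obtain ⟨s, hedge, hrot⟩ := X.exists_potential (X.diagonal d) (by
    intro a b
    rw [X.sum_diagonal_mul, hd, CharTwo.add_self_eq_zero])
  obtain ⟨t, ht⟩ := X.exists_eq_of_connected (hprime.2 {X.crossingOf d} (by simp)) hedge
    (fun e he => by rw [hrot, X.diagonal_of_crossingOf_ne (by simpa using he), add_zero])
  obtain ⟨x, hx, hxt, hx2, hx3⟩ := X.exists_side (s := s) (d := d)
    (by rw [hrot, X.diagonal_self, add_zero]) (by rw [hrot, X.diagonal_rot])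
    (by rw [hrot, X.diagonal_rot_rot, add_zero]) t
  have hxd : X.crossingOf x = X.crossingOf d := by
    rcases hx with rfl | rfl <;> simp only [X.crossingOf_rot]
  have hxe : X.crossingOf (X.edge x) = X.crossingOf d := by
    by_contra h
    exact hxt (by rw [← hedge, ht _ (by simpa using h)])
  rcases X.eq_of_crossingOf_eq (hxd.trans hxe.symm) with h | h | h | h
  · exact X.edge_ne x h
  · exact X.edge_ne_rot hmin x h
  · exact hxt (by rw [← hedge, h, hx2])
  · exact hxt (by rw [← hedge, h, hx3])

/-- Otherwise the two diagonals form a closed curve. Its side free of other crossings contains two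
adjacent darts at each of the two crossings, and joining these in pairs produces a monogon or a
bigon. -/
theorem regionOf_rot_rot_injective [Finite D] (hmin : X.IsMinimal) (hprime : X.IsPrime)
    {d d' : D} (hr : X.regionOf d = X.regionOf d')
    (hg : X.regionOf (X.rot (X.rot d)) = X.regionOf (X.rot (X.rot d'))) : d = d' := by
  classical
  cases nonempty_fintype D
  obtain ⟨c, hce, hcr, hc⟩ := X.exists_coloring
  have hc1 : ∀ e, c e ≠ c e + 1 := fun e h => one_ne_zero (left_eq_add.1 h)
  have hc2 : ∀ e, c (X.rot (X.rot e)) = c e := fun e => by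
    rw [hcr, hcr, CharTwo.add_cancel_right]
  by_contra hne
  have hcross : X.crossingOf d ≠ X.crossingOf d' := by
    intro h
    rcases X.eq_of_crossingOf_eq h with rfl | rfl | rfl | rfl
    · exact hne rfl
    · exact hc1 d (by rw [← hcr, ← hc _ _ hr])
    · exact X.regionOf_rot_rot_ne hmin hprime d hr.symm
    · exact hc1 d (by rw [← hcr, ← hc2 (X.rot d), ← hc _ _ hr])
  obtain ⟨s, hedge, hrot⟩ := X.exists_potential (X.diagonal d + X.diagonal d') (by
    intro a b
    simp only [Pi.add_apply, add_mul (X.diagonal d _), Finset.sum_add_distrib]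
    rw [X.sum_diagonal_mul, X.sum_diagonal_mul, hr, hg, CharTwo.add_self_eq_zero])
  obtain ⟨t, ht⟩ := X.exists_eq_of_connected
    (hprime.2 {X.crossingOf d, X.crossingOf d'} (Finset.card_le_two.trans_lt (by norm_num))) hedge
    (fun e he => by
      simp only [Finset.mem_insert, Finset.mem_singleton, not_or] at he
      rw [hrot, Pi.add_apply, X.diagonal_of_crossingOf_ne he.1, X.diagonal_of_crossingOf_ne he.2,
        add_zero, add_zero])
  have hside : ∀ e e', X.crossingOf e ≠ X.crossingOf e' →
      (∀ f, s (X.rot f) = s f + (X.diagonal e f + X.diagonal e' f)) →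
      ∃ x, (x = e ∨ x = X.rot (X.rot e)) ∧ s x ≠ t ∧ s (X.rot (X.rot x)) = t ∧
        s (X.rot (X.rot (X.rot x))) = t := by
    intro e e' hee hs
    refine X.exists_side ?_ ?_ ?_ t
    · rw [hs, X.diagonal_self, X.diagonal_of_crossingOf_ne hee, add_zero, add_zero]
    · rw [hs, X.diagonal_rot, X.diagonal_of_crossingOf_ne (by rwa [X.crossingOf_rot]), add_zero]
    · rw [hs, X.diagonal_rot_rot,
        X.diagonal_of_crossingOf_ne (by rwa [X.crossingOf_rot, X.crossingOf_rot]), add_zero,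
        add_zero]
  obtain ⟨x, hx, hxt, hx2, hx3⟩ := hside d d' hcross hrot
  obtain ⟨y, hy, hyt, hy2, hy3⟩ := hside d' d hcross.symm (fun f => by
    rw [hrot, Pi.add_apply, add_comm (X.diagonal d f)])
  have hxd : X.crossingOf x = X.crossingOf d := by
    rcases hx with rfl | rfl <;> simp only [X.crossingOf_rot]
  have hyd : X.crossingOf y = X.crossingOf d' := by
    rcases hy with rfl | rfl <;> simp only [X.crossingOf_rot]
  have hxc : c x = c d := by rcases hx with rfl | rfl <;> simp only [hc2]
  have hyc : c y = c d := by rw [hc _ _ hr]; rcases hy with rfl | rfl <;> simp only [hc2]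
  have hsd : s (X.rot x) ≠ t := by
    rw [hrot, Pi.add_apply, X.diagonal_of_crossingOf_ne (d := d') (by rwa [hxd])]
    rcases hx with rfl | rfl
    · rwa [X.diagonal_self, add_zero, add_zero]
    · rwa [X.diagonal_rot_rot, add_zero, add_zero]
  have hend : ∀ z, s z ≠ t → (z = x ∨ z = X.rot x) ∨
      (z = y ∨ z = X.rot y) := by
    intro z hz
    have hzS : X.crossingOf z = X.crossingOf d ∨ X.crossingOf z = X.crossingOf d' := by
      by_contra h
      exact hz (ht z (by simpa using h))
    rcases hzS with h | h
    · refine Or.inl ?_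
      rcases X.eq_of_crossingOf_eq (hxd.trans h.symm) with rfl | rfl | rfl | rfl
      exacts [Or.inl rfl, Or.inr rfl, absurd hx2 hz, absurd hx3 hz]
    · refine Or.inr ?_
      rcases X.eq_of_crossingOf_eq (hyd.trans h.symm) with rfl | rfl | rfl | rfl
      exacts [Or.inl rfl, Or.inr rfl, absurd hy2 hz, absurd hy3 hz]
  have h1 : X.edge x = X.rot y := by
    rcases hend (X.edge x) (by rwa [hedge]) with (h | h) | h | h
    · exact absurd h (X.edge_ne x)
    · exact absurd h (X.edge_ne_rot hmin x)
    -- The colouring rules out the crossed pairing, since `edge` flips colour while `x` and `y`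
    -- share it.
    · exact absurd (by rw [← hce, h, hyc, hxc]) (hc1 x)
    · exact h
  have h2 : X.edge (X.rot x) = y := by
    rcases hend (X.edge (X.rot x)) (by rwa [hedge]) with (h | h) | h | h
    · exact absurd (by conv_lhs => rw [← h, X.edge_edge]) (X.edge_ne_rot hmin x)
    · exact absurd h (X.edge_ne _)
    · exact h
    · exact absurd (by rw [← hce, h, hcr, hcr, hyc, hxc]) (hc1 (X.rot x))
  -- The two parallel edges bound a bigon through `rot x`.
  refine X.not_face_face_eq hmin (X.rot x) ?_
  change X.rot (X.edge (X.rot (X.edge (X.rot x)))) = X.rot x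
  rw [h2, ← h1, X.edge_edge]

/-! ### The count of darts of one colour. -/

/-- The regions opposite to `r` at its crossings are pairwise distinct, distinct from `r`, and have
the same colour as `r`; so they and `r` together account for at most half of the darts. -/
theorem two_mul_size_le_crossingNumber [Finite D] (hmin : X.IsMinimal) (hprime : X.IsPrime)
    (r : X.Region) : 2 * X.size r ≤ X.crossingNumber := by
  classical
  cases nonempty_fintype D
  obtain ⟨c, hce, hcr, hc⟩ := X.exists_coloring
  have hc2 : ∀ e, c (X.rot (X.rot e)) = c e := fun e => by
    rw [hcr, hcr, CharTwo.add_cancel_right]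
  induction r using Quotient.inductionOn with
  | h d₀ =>
  change 2 * X.size (X.regionOf d₀) ≤ _
  let B : X.Region → Finset D := fun q => Finset.univ.filter fun d => X.regionOf d = q
  have hB : ∀ q, (B q).card = X.size q := fun q => by
    rw [FourValentMap.size, Nat.card_eq_fintype_card, Fintype.card_subtype]
  have hmem : ∀ q d, d ∈ B q ↔ X.regionOf d = q := fun q d => by simp [B]
  let R := B (X.regionOf d₀)
  let O := R.biUnion fun d => B (X.regionOf (X.rot (X.rot d)))
  have hdisj : Disjoint R O := by
    refine Finset.disjoint_left.2 fun e he he' => ?_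
    obtain ⟨d, hd, hde⟩ := Finset.mem_biUnion.1 he'
    rw [hmem] at he hd hde
    exact X.regionOf_rot_rot_ne hmin hprime d (by rw [← hde, he, hd])
  have hO : 3 * R.card ≤ O.card := by
    rw [Finset.card_biUnion, mul_comm, ← smul_eq_mul]
    · exact Finset.card_nsmul_le_sum _ _ _ fun d _ => (hB _).symm ▸ X.three_le_size hmin _
    · intro d hd d' hd' hne
      refine Finset.disjoint_left.2 fun e he he' => hne ?_
      rw [Finset.mem_coe, hmem] at hd hd'
      rw [hmem] at he he'
      exact X.regionOf_rot_rot_injective hmin hprime (hd.trans hd'.symm) (he.symm.trans he')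
  have hsub : R ∪ O ⊆ Finset.univ.filter fun d => c d = c d₀ := by
    intro e he
    rw [Finset.mem_filter]
    refine ⟨Finset.mem_univ _, ?_⟩
    rcases Finset.mem_union.1 he with he | he
    · exact hc _ _ ((hmem _ _).1 he)
    · obtain ⟨d, hd, hde⟩ := Finset.mem_biUnion.1 he
      rw [hmem] at hd hde
      rw [hc _ _ hde, hc2, hc _ _ hd]
  -- Each edge has one dart of each colour.
  have hhalf : (Finset.univ.filter fun d => c d = c d₀).card
      = (Finset.univ.filter fun d => ¬ c d = c d₀).card := by
    have key : ∀ u v : ZMod 2, u + 1 = v ↔ u ≠ v := by decide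
    refine Finset.card_equiv X.edge fun d => ?_
    simp only [Finset.mem_filter, Finset.mem_univ, true_and, hce, key, not_not]
  have htot := Finset.card_filter_add_card_filter_not (s := (Finset.univ : Finset D))
    (fun d => c d = c d₀)
  have h4 := X.card_dart_eq_four_mul
  have hle := Finset.card_le_card hsub
  rw [Finset.card_union_of_disjoint hdisj] at hle
  rw [Finset.card_univ, ← Nat.card_eq_fintype_card, h4] at htot
  rw [← hB, crossingNumber]
  change 2 * R.card ≤ _
  omega

end DoodleDiagram

theorem lemma6p7 {D : Type*} [Finite D] (X : DoodleDiagram D) (hmin : X.IsMinimal)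
    (hprime : X.IsPrime) (r : X.Region) :
    (X.size r : ℝ) < ((X.crossingNumber : ℝ) + 1) / 2 := by
  have h : (2 * X.size r : ℝ) ≤ X.crossingNumber := by
    exact_mod_cast X.two_mul_size_le_crossingNumber hmin hprime r
  linarith
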